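/- **Lemma (tidal curvature of a Rosen metric).** Let $\mathbb U\subset\mathbb R$ be a nondegenerate interval, $\mathbb X$ a finite-dimensional real Euclidean space, and let $h(u)$, $u\in\mathbb U$, be a positive-definite symmetric endomorphism of $\mathbb X$ depending smoothly on $u$. Consider the Rosen metric $$G_\rho(h)=2\,du\,dv-dx^T h(u)\,dx$$ on $\mathbb M=\mathbb U\times\mathbb R\times\mathbb X$, with Levi-Civita connection $\nabla$ and curvature $R(X,Y)Z=\nabla_X\nabla_YZ-\nabla_Y\nabla_XZ-\nabla_{[X,Y]}Z$. Let $H:\mathbb U\to\operatorname{End}(\mathbb X)$ be any function with $\dot H=h^{-1}$, where dots (or primes) denote derivatives in $u$. Then: 1. The central curve $\gamma(u)=(u,0,0)$ is an affinely parametrized null geodesic of $G_\rho(h)$. 2. At each $u\in\mathbb U$, the form $(\xi,\eta)\mapsto G_\rho(h)\bigl(R(\xi,\dot\gamma)\dot\gamma,\eta\bigr)$ on $\dot\gamma^\perp$ descends to a unique bilinear form $P$ on the normal space $\dot\gamma^\perp/\langle\dot\gamma\rangle$, the normal tidal curvature of $\gamma$, and $$P=-\tfrac12\,dx^T\,\dot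 H^{-1}\Bigl(\dddot H-\tfrac32\,\ddot H\dot H^{-1}\ddot H\Bigr)\dot H^{-1}\,dx .$$ 3. Consequently the normal tidal curvature is given by the Lagrange–Schwarzian: let $L:\mathbb U\to\operatorname{End}(\mathbb X)$ be any Lagrangian matrix (that is, $L$ is smooth, $L^T\dot L$ is symmetric, and $L\oplus\dot L:\mathbb X\to\mathbb X\oplus\mathbb X$ has full rank) with $L^TL=h$, and let $\mathcal S=L\bigl(\dddot H-\tfrac32\,\ddot H\dot H^{-1}\ddot H\bigr)L^T$ be the Lagrange–Schwarzian of $H$ relative to $L$. Then $$P=-\tfrac12\,(L\,dx)^T\,\mathcal S\,(L\,dx).$$ -/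

import Mathlib

open scoped ContDiff InnerProductSpace

noncomputable section

/-! Pseudo-Riemannian geometry on a subset `M` of a normed space `E` (a single global chart).
A metric is a field `g` of bilinear forms; every derivative is taken within `M`. -/

section Geometry

variable {E : Type*} [NormedAddCommGroup E] [NormedSpace ℝ E]

/-- The Christoffel symbols of the first kind, as the covector
`Z ↦ ½ (∂_X g(Y, Z) + ∂_Y g(X, Z) - ∂_Z g(X, Y))`. -/
def christoffelFirst (g : E → E →L[ℝ] E →L[ℝ] ℝ) (M : Set E) (p X Y : E) : E →L[ℝ] ℝ :=
  (1 / 2 : ℝ) • (fderivWithin ℝ g M p X Y + fderivWithin ℝ g M p Y X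
    - ((fderivWithin ℝ g M p).flip X).flip Y)

/-- The Christoffel symbols `Γ_p(X, Y)` of the Levi-Civita connection: the index of
`christoffelFirst` is raised by the inverse of `g p`, regarded as a map from vectors to covectors. -/
def christoffel (g : E → E →L[ℝ] E →L[ℝ] ℝ) (M : Set E) (p X Y : E) : E :=
  (g p).inverse (christoffelFirst g M p X Y)

/-- The Riemann curvature `R(X, Y) Z = ∇_X ∇_Y Z - ∇_Y ∇_X Z - ∇_[X, Y] Z` at `p`, evaluated on
the constant extensions of the vectors `X`, `Y`, `Z`, whose brackets vanish. -/
def riemann (g : E → E →L[ℝ] E →L[ℝ] ℝ) (M : Set E) (p X Y Z : E) : E :=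
  fderivWithin ℝ (fun q => christoffel g M q Y Z) M p X
    - fderivWithin ℝ (fun q => christoffel g M q X Z) M p Y
    + christoffel g M p X (christoffel g M p Y Z)
    - christoffel g M p Y (christoffel g M p X Z)

/-- The curve `c : U → M` is an affinely parametrized null geodesic of `g`. -/
structure IsNullGeodesic (g : E → E →L[ℝ] E →L[ℝ] ℝ) (M : Set E) (U : Set ℝ) (c : ℝ → E) :
    Prop where
  mapsTo : Set.MapsTo c U M
  smooth : ContDiffOn ℝ ∞ c U
  tangent_ne_zero : ∀ u ∈ U, derivWithin c U u ≠ 0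
  null : ∀ u ∈ U, g (c u) (derivWithin c U u) (derivWithin c U u) = 0
  geodesic : ∀ u ∈ U, iteratedDerivWithin 2 c U u
    + christoffel g M (c u) (derivWithin c U u) (derivWithin c U u) = 0

/-- The vectors orthogonal to `T`. -/
abbrev orthVectors (b : E →L[ℝ] E →L[ℝ] ℝ) (T : E) : Submodule ℝ E :=
  LinearMap.ker (b T : E →ₗ[ℝ] ℝ)

/-- The normal space `T^⊥ / T` of a null direction `T`. -/
abbrev ScreenSpace (b : E →L[ℝ] E →L[ℝ] ℝ) (T : E) : Type _ :=
  orthVectors b T ⧸ (Submodule.span ℝ {T}).submoduleOf (orthVectors b T)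

/-- The class in `T^⊥ / T` of a vector of `T^⊥`. -/
abbrev screenClass (b : E →L[ℝ] E →L[ℝ] ℝ) (T : E) (ξ : orthVectors b T) : ScreenSpace b T :=
  Submodule.Quotient.mk ξ

/-- `P` is the normal tidal curvature at `p` of a null geodesic with tangent vector `T` there: the
bilinear form on `T^⊥ / T` induced by `(ξ, η) ↦ g(R(ξ, T) T, η)`. -/
def IsNormalTidalCurvature (g : E → E →L[ℝ] E →L[ℝ] ℝ) (M : Set E) (p T : E)
    (P : LinearMap.BilinForm ℝ (ScreenSpace (g p) T)) : Prop :=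
  ∀ ξ η : orthVectors (g p) T,
    P (screenClass (g p) T ξ) (screenClass (g p) T η) = g p (riemann g M p ξ T T) η

end Geometry

section Rosen

variable {X : Type*} [NormedAddCommGroup X] [InnerProductSpace ℝ X]

/-- The spacetime `U × ℝ × X`, with coordinates `(u, v, x)`, as a subset of `ℝ × ℝ × X`. -/
def spacetime (X : Type*) (U : Set ℝ) : Set (ℝ × ℝ × X) := {p | p.1 ∈ U}

/-- `h` is a positive-definite symmetric endomorphism of `X` depending smoothly on `u ∈ U`. -/
structure IsRosenProfile (U : Set ℝ) (h : ℝ → X →L[ℝ] X) : Prop where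
  smooth : ContDiffOn ℝ ∞ h U
  symmetric : ∀ u ∈ U, ∀ x y : X, ⟪h u x, y⟫_ℝ = ⟪x, h u y⟫_ℝ
  posDef : ∀ u ∈ U, ∀ x : X, x ≠ 0 → 0 < ⟪x, h u x⟫_ℝ

/-- The coordinate differential `du`. -/
def formU (X : Type*) [NormedAddCommGroup X] [InnerProductSpace ℝ X] : (ℝ × ℝ × X) →L[ℝ] ℝ :=
  ContinuousLinearMap.fst ℝ ℝ (ℝ × X)

/-- The coordinate differential `dv`. -/
def formV (X : Type*) [NormedAddCommGroup X] [InnerProductSpace ℝ X] : (ℝ × ℝ × X) →L[ℝ] ℝ :=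
  (ContinuousLinearMap.fst ℝ ℝ X).comp (ContinuousLinearMap.snd ℝ ℝ (ℝ × X))

/-- The vector-valued coordinate differential `dx`. -/
def formX (X : Type*) [NormedAddCommGroup X] [InnerProductSpace ℝ X] : (ℝ × ℝ × X) →L[ℝ] X :=
  (ContinuousLinearMap.snd ℝ ℝ X).comp (ContinuousLinearMap.snd ℝ ℝ (ℝ × X))

/-- The Euclidean inner product of `X` as a continuous bilinear form. -/
def euclInner (X : Type*) [NormedAddCommGroup X] [InnerProductSpace ℝ X] : X →L[ℝ] X →L[ℝ] ℝ :=
  innerSL ℝ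

/-- The Rosen metric `2 du dv - dxᵀ h(u) dx`. -/
def rosenMetric (h : ℝ → X →L[ℝ] X) (p : ℝ × ℝ × X) :
    (ℝ × ℝ × X) →L[ℝ] (ℝ × ℝ × X) →L[ℝ] ℝ :=
  (formU X).smulRight (formV X) + (formV X).smulRight (formU X)
    - (euclInner X).bilinearComp (formX X) ((h p.1).comp (formX X))

theorem rosenMetric_apply (h : ℝ → X →L[ℝ] X) (p ξ η : ℝ × ℝ × X) :
    rosenMetric h p ξ η = ξ.1 * η.2.1 + ξ.2.1 * η.1 - ⟪ξ.2.2, h p.1 η.2.2⟫_ℝ := by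
  simp [rosenMetric, formU, formV, formX, euclInner]
  rfl

/-- The central null geodesic `u ↦ (u, 0, 0)`. -/
def centralCurve (X : Type*) [NormedAddCommGroup X] [InnerProductSpace ℝ X] (u : ℝ) : ℝ × ℝ × X :=
  (u, 0, 0)

/-- The tangent vector `∂_u` of the central null geodesic. -/
def centralTangent (X : Type*) [NormedAddCommGroup X] [InnerProductSpace ℝ X] (U : Set ℝ) (u : ℝ) :
    ℝ × ℝ × X :=
  derivWithin (centralCurve X) U u

/-- The operator `H''' - (3/2) H'' (H')⁻¹ H''`. -/
def schwarzOperator (U : Set ℝ) (H : ℝ → X →L[ℝ] X) (u : ℝ) : X →L[ℝ] X :=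
  iteratedDerivWithin 3 H U u - (3 / 2 : ℝ) •
    ((iteratedDerivWithin 2 H U u).comp
      ((derivWithin H U u).inverse.comp (iteratedDerivWithin 2 H U u)))

variable [FiniteDimensional ℝ X]

/-- The transpose of an endomorphism of the Euclidean space `X`. -/
def euclTranspose (A : X →L[ℝ] X) : X →L[ℝ] X :=
  LinearMap.toContinuousLinearMap (LinearMap.adjoint (A : X →ₗ[ℝ] X))

/-- Lagrangian matrices: `L` is smooth, `Lᵀ L'` is symmetric, and `L ⊕ L' : X → X ⊕ X` has full
rank. -/
structure IsLagrangianMatrix (U : Set ℝ) (L : ℝ → X →L[ℝ] X) : Prop where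
  smooth : ContDiffOn ℝ ∞ L U
  symmetric : ∀ u ∈ U, (euclTranspose (L u)).comp (derivWithin L U u)
    = (euclTranspose (derivWithin L U u)).comp (L u)
  fullRank : ∀ u ∈ U, ∀ x : X, L u x = 0 → derivWithin L U u x = 0 → x = 0

/-- The Lagrange--Schwarzian `L (H''' - (3/2) H'' (H')⁻¹ H'') Lᵀ` of `H` relative to `L`. -/
def lagrangeSchwarzian (U : Set ℝ) (H L : ℝ → X →L[ℝ] X) (u : ℝ) : X →L[ℝ] X :=
  (L u).comp ((schwarzOperator U H u).comp (euclTranspose (L u)))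

end Rosen

end

/-! In a Rosen chart only the `u`-derivative of the metric survives, and the Christoffel symbols are
`Γ(A, B) = (0, ½ ⟨A_x, h' B_x⟩, ½ h⁻¹ h' (A_u B_x + B_u A_x))`. Hence `Γ(∂_u, ∂_u) = 0`, so the
central curve is a geodesic, and `Γ(ξ, ∂_u)` is `½ h⁻¹ h'` acting on the `x`-component of `ξ`.
Differentiating the latter gives `R(ξ, ∂_u) ∂_u = -½ h⁻¹ W ξ_x` with `W = h'' - ½ h' h⁻¹ h'`, so that
the tidal form is `½ ⟨ξ_x, W η_x⟩`. On the other hand, three derivatives of `H' = h⁻¹` show that the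
matrix Schwarzian of `H` is `-h⁻¹ W h⁻¹`, that is `W = -H'⁻¹ (H''' - 3/2 H'' H'⁻¹ H'') H'⁻¹`. -/

section RingInverse

open scoped Ring

variable {𝕜 R : Type*} [NontriviallyNormedField 𝕜] [NormedRing R] [HasSummableGeomSeries R]
  [NormedAlgebra 𝕜 R] {f f' H : 𝕜 → R} {a b : R} {s : Set 𝕜} {t : 𝕜}

theorem hasDerivWithinAt_ringInverse (hf : HasDerivWithinAt f a s t) (ht : IsUnit (f t)) :
    HasDerivWithinAt (fun x => (f x)⁻¹ʳ) (-((f t)⁻¹ʳ * a * (f t)⁻¹ʳ)) s t := by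
  obtain ⟨e, he⟩ := ht
  have hinv := hasFDerivAt_ringInverse (𝕜 := 𝕜) e
  rw [he] at hinv
  simpa [← he, Function.comp_def] using hinv.comp_hasDerivWithinAt t hf

theorem hasDerivWithinAt_deriv_ringInverse (hf : HasDerivWithinAt f (f' t) s t)
    (hf' : HasDerivWithinAt f' b s t) (ht : IsUnit (f t)) :
    HasDerivWithinAt (fun x => -((f x)⁻¹ʳ * f' x * (f x)⁻¹ʳ))
      (2 * ((f t)⁻¹ʳ * f' t * (f t)⁻¹ʳ * f' t * (f t)⁻¹ʳ) - (f t)⁻¹ʳ * b * (f t)⁻¹ʳ) s t := by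
  have hinv := hasDerivWithinAt_ringInverse hf ht
  refine ((hinv.mul hf').mul hinv).neg.congr_deriv ?_
  simp only [Pi.mul_apply]
  noncomm_ring

theorem iteratedDerivWithin_two_of_deriv_eq_ringInverse (hs : UniqueDiffOn 𝕜 s)
    (hH : ∀ x ∈ s, HasDerivWithinAt H (f x)⁻¹ʳ s x) (hu : ∀ x ∈ s, IsUnit (f x))
    (hf : ∀ x ∈ s, HasDerivWithinAt f (f' x) s x) (ht : t ∈ s) :
    iteratedDerivWithin 2 H s t = -((f t)⁻¹ʳ * f' t * (f t)⁻¹ʳ) := by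
  have hH' : Set.EqOn (derivWithin H s) (fun x => (f x)⁻¹ʳ) s := fun x hx =>
    (hH x hx).derivWithin (hs x hx)
  rw [iteratedDerivWithin_succ, iteratedDerivWithin_one, derivWithin_congr hH' (hH' ht)]
  exact (hasDerivWithinAt_ringInverse (hf t ht) (hu t ht)).derivWithin (hs t ht)

theorem iteratedDerivWithin_three_of_deriv_eq_ringInverse (hs : UniqueDiffOn 𝕜 s)
    (hH : ∀ x ∈ s, HasDerivWithinAt H (f x)⁻¹ʳ s x) (hu : ∀ x ∈ s, IsUnit (f x))
    (hf : ∀ x ∈ s, HasDerivWithinAt f (f' x) s x) (ht : t ∈ s) (hf' : HasDerivWithinAt f' b s t) :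
    iteratedDerivWithin 3 H s t =
      2 * ((f t)⁻¹ʳ * f' t * (f t)⁻¹ʳ * f' t * (f t)⁻¹ʳ) - (f t)⁻¹ʳ * b * (f t)⁻¹ʳ := by
  have hH'' : Set.EqOn (iteratedDerivWithin 2 H s) (fun x => -((f x)⁻¹ʳ * f' x * (f x)⁻¹ʳ)) s :=
    fun x hx => iteratedDerivWithin_two_of_deriv_eq_ringInverse hs hH hu hf hx
  rw [iteratedDerivWithin_succ, derivWithin_congr hH'' (hH'' ht)]
  exact (hasDerivWithinAt_deriv_ringInverse (hf t ht) hf' (hu t ht)).derivWithin (hs t ht)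

end RingInverse

section Calculus

variable {𝕜 E F : Type*} [NontriviallyNormedField 𝕜] [NormedAddCommGroup E] [NormedSpace 𝕜 E]
  [NormedAddCommGroup F] [NormedSpace 𝕜 F] {s : Set 𝕜}

theorem hasDerivWithinAt_iteratedDerivWithin {f : 𝕜 → F} {n : ℕ} (hf : ContDiffOn 𝕜 (n + 1) f s)
    (hs : UniqueDiffOn 𝕜 s) {t : 𝕜} (ht : t ∈ s) :
    HasDerivWithinAt (iteratedDerivWithin n f s) (iteratedDerivWithin (n + 1) f s t) s t := by
  rw [iteratedDerivWithin_succ]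
  exact (hf.differentiableOn_iteratedDerivWithin (mod_cast n.lt_succ_self) hs t ht).hasDerivWithinAt

theorem hasFDerivWithinAt_comp_fst {f : 𝕜 → F} {f' : F} {p : 𝕜 × E}
    (hf : HasDerivWithinAt f f' s p.1) :
    HasFDerivWithinAt (fun q : 𝕜 × E => f q.1)
      ((ContinuousLinearMap.fst 𝕜 𝕜 E).smulRight f') (Prod.fst ⁻¹' s) p :=
  (hf.hasFDerivWithinAt.comp p hasFDerivWithinAt_fst fun _ hq => hq).congr_fderiv <| by
    ext <;> simp

theorem isInvertible_of_bijective [CompleteSpace E] [CompleteSpace F] {f : E →L[𝕜] F}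
    (hf : Function.Bijective f) : f.IsInvertible :=
  ⟨.ofBijective f (LinearMap.ker_eq_bot.2 hf.1) (LinearMap.range_eq_top.2 hf.2),
    ContinuousLinearEquiv.coe_ofBijective _ _ _⟩

end Calculus

theorem isSelfAdjoint_of_hasDerivWithinAt {A : Type*} [NormedAddCommGroup A] [NormedSpace ℝ A]
    [StarAddMonoid A] [StarModule ℝ A] [ContinuousStar A] {f : ℝ → A} {f' : A} {s : Set ℝ} {t : ℝ}
    (hf : HasDerivWithinAt f f' s t) (hs : UniqueDiffWithinAt ℝ s t) (ht : t ∈ s)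
    (hsa : ∀ x ∈ s, IsSelfAdjoint (f x)) : IsSelfAdjoint f' :=
  hs.eq_deriv _ (hf.star.congr (fun x hx => (hsa x hx).symm) (hsa t ht).symm) hf

section InnerProduct

variable {X Y : Type*} [NormedAddCommGroup X] [InnerProductSpace ℝ X] [CompleteSpace X]
  [NormedAddCommGroup Y] [InnerProductSpace ℝ Y] [CompleteSpace Y]

theorem inner_inverse_apply_apply {A K : X →L[ℝ] X} (hi : A.IsInvertible) (hA : IsSelfAdjoint A)
    (hK : IsSelfAdjoint K) (x y : X) : ⟪A.inverse (K x), A y⟫_ℝ = ⟪x, K y⟫_ℝ :=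
  calc ⟪A.inverse (K x), A y⟫_ℝ = ⟪A (A.inverse (K x)), y⟫_ℝ := (hA.isSymmetric _ _).symm
    _ = ⟪K x, y⟫_ℝ := by rw [hi.self_apply_inverse]
    _ = ⟪x, K y⟫_ℝ := hK.isSymmetric x y

theorem inner_apply_conj_adjoint_apply (L : X →L[ℝ] Y) (S : X →L[ℝ] X) (x y : X) :
    ⟪L x, (L ∘L S ∘L ContinuousLinearMap.adjoint L) (L y)⟫_ℝ =
      ⟪x, (ContinuousLinearMap.adjoint L ∘L L) (S ((ContinuousLinearMap.adjoint L ∘L L) y))⟫_ℝ := by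
  simp [ContinuousLinearMap.adjoint_inner_right]

end InnerProduct

section ScreenSpace

variable {E F : Type*} [NormedAddCommGroup E] [NormedSpace ℝ E] [AddCommGroup F] [Module ℝ F]

/-- The bilinear form on the screen space `T^⊥ / T` obtained by pulling back a bilinear form `B`
along a linear map `q` that vanishes at `T`. -/
noncomputable def screenForm (b : E →L[ℝ] E →L[ℝ] ℝ) {T : E} (q : E →ₗ[ℝ] F) (hq : q T = 0)
    (B : LinearMap.BilinForm ℝ F) : LinearMap.BilinForm ℝ (ScreenSpace b T) :=
  let qbar : ScreenSpace b T →ₗ[ℝ] F :=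
    Submodule.liftQ _ (q ∘ₗ (orthVectors b T).subtype) <| by
      rw [LinearMap.ker_comp]
      exact Submodule.comap_mono ((Submodule.span_singleton_le_iff_mem _ _).2 hq)
  B.compl₁₂ qbar qbar

theorem screenForm_apply (b : E →L[ℝ] E →L[ℝ] ℝ) {T : E} (q : E →ₗ[ℝ] F) (hq : q T = 0)
    (B : LinearMap.BilinForm ℝ F) (ξ η : orthVectors b T) :
    screenForm b q hq B (screenClass b T ξ) (screenClass b T η) = B (q ξ) (q η) :=
  rfl

theorem IsNormalTidalCurvature.unique {g : E → E →L[ℝ] E →L[ℝ] ℝ} {M : Set E} {p T : E}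
    {P Q : LinearMap.BilinForm ℝ (ScreenSpace (g p) T)}
    (hP : IsNormalTidalCurvature g M p T P) (hQ : IsNormalTidalCurvature g M p T Q) : P = Q := by
  refine LinearMap.ext₂ fun x y => ?_
  obtain ⟨ξ, rfl⟩ := Submodule.Quotient.mk_surjective _ x
  obtain ⟨η, rfl⟩ := Submodule.Quotient.mk_surjective _ y
  exact (hP ξ η).trans (hQ ξ η).symm

end ScreenSpace

section RosenCurvature

set_option maxSynthPendingDepth 3

open scoped Ring

variable {X : Type*} [NormedAddCommGroup X] [InnerProductSpace ℝ X] {U : Set ℝ} {u : ℝ}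
  {h : ℝ → X →L[ℝ] X} {h' : X →L[ℝ] X} {p : ℝ × ℝ × X}

theorem uniqueDiffOn_spacetime (hU : UniqueDiffOn ℝ U) : UniqueDiffOn ℝ (spacetime X U) := by
  have hprod := hU.prod (uniqueDiffOn_univ (𝕜 := ℝ) (E := ℝ × X))
  rwa [Set.prod_univ] at hprod

theorem hasDerivWithinAt_centralCurve (U : Set ℝ) (u : ℝ) :
    HasDerivWithinAt (centralCurve X) (1, 0, 0) U u :=
  (hasDerivWithinAt_id u U).prodMk
    ((hasDerivWithinAt_const u U (0 : ℝ)).prodMk (hasDerivWithinAt_const u U (0 : X)))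

theorem centralTangent_eq (hu : UniqueDiffWithinAt ℝ U u) : centralTangent X U u = (1, 0, 0) :=
  (hasDerivWithinAt_centralCurve U u).derivWithin hu

theorem formX_centralTangent (hu : UniqueDiffWithinAt ℝ U u) :
    formX X (centralTangent X U u) = 0 := by
  rw [centralTangent_eq hu]
  rfl

/-- The operator `W = h'' - ½ h' h⁻¹ h'`, which represents twice the tidal form of the Rosen metric
of `h` with respect to the inner product of `X`. -/
noncomputable def tidalOperator (U : Set ℝ) (h : ℝ → X →L[ℝ] X) (u : ℝ) : X →L[ℝ] X :=
  iteratedDerivWithin 2 h U u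
    - (1 / 2 : ℝ) • (derivWithin h U u * (h u).inverse * derivWithin h U u)

/-- The normal tidal curvature of the central geodesic of the Rosen metric of `h`, as the form
`½ dxᵀ W dx` with `W = tidalOperator U h u`. -/
noncomputable def rosenTidalForm (h : ℝ → X →L[ℝ] X) (hu : UniqueDiffWithinAt ℝ U u) :
    LinearMap.BilinForm ℝ
      (ScreenSpace (rosenMetric h (centralCurve X u)) (centralTangent X U u)) :=
  screenForm _ (formX X : (ℝ × ℝ × X) →ₗ[ℝ] X) (formX_centralTangent hu)
    ((1 / 2 : ℝ) • (innerₗ X).compl₂ (tidalOperator U h u : X →ₗ[ℝ] X))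

theorem rosenTidalForm_apply (hu : UniqueDiffWithinAt ℝ U u)
    (ξ η : orthVectors (rosenMetric h (centralCurve X u)) (centralTangent X U u)) :
    rosenTidalForm h hu (screenClass _ _ ξ) (screenClass _ _ η)
      = (1 / 2 : ℝ) * ⟪formX X ξ, tidalOperator U h u (formX X η)⟫_ℝ :=
  screenForm_apply _ _ _ _ ξ η

variable (X) in
/-- The form `dxᵀ K dx` on the spacetime as a continuous linear function of the operator `K`; the
Rosen metric is `2 du dv - transverseForm X (h u)`. -/
noncomputable def transverseForm : (X →L[ℝ] X) →L[ℝ] (ℝ × ℝ × X) →L[ℝ] (ℝ × ℝ × X) →L[ℝ] ℝ :=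
  (ContinuousLinearMap.flipₗᵢ ℝ (ℝ × ℝ × X) (ℝ × ℝ × X) ℝ).toContinuousLinearEquiv ∘L
    ContinuousLinearMap.compL ℝ (ℝ × ℝ × X) X ((ℝ × ℝ × X) →L[ℝ] ℝ)
      (euclInner X ∘L formX X).flip ∘L
    (ContinuousLinearMap.compL ℝ (ℝ × ℝ × X) X X).flip (formX X)

theorem transverseForm_apply (K : X →L[ℝ] X) (ξ η : ℝ × ℝ × X) :
    transverseForm X K ξ η = ⟪ξ.2.2, K η.2.2⟫_ℝ :=
  rfl

theorem hasFDerivWithinAt_rosenMetric (hd : HasDerivWithinAt h h' U p.1) :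
    HasFDerivWithinAt (rosenMetric h) (-(formU X).smulRight (transverseForm X h'))
      (spacetime X U) p := by
  have hform := hasFDerivWithinAt_comp_fst (E := ℝ × X)
    ((transverseForm X).hasFDerivAt.comp_hasDerivWithinAt p.1 hd)
  exact hform.const_sub ((formU X).smulRight (formV X) + (formV X).smulRight (formU X))

theorem fderivWithin_rosenMetric_apply (hU : UniqueDiffOn ℝ U) (hp : p ∈ spacetime X U)
    (hd : HasDerivWithinAt h h' U p.1) (A B C : ℝ × ℝ × X) :
    fderivWithin ℝ (rosenMetric h) (spacetime X U) p A B C = -(A.1 * ⟪B.2.2, h' C.2.2⟫_ℝ) := by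
  rw [(hasFDerivWithinAt_rosenMetric hd).fderivWithin (uniqueDiffOn_spacetime hU p hp)]
  simp [formU, transverseForm_apply]

theorem injective_rosenMetric (hi : (h p.1).IsInvertible) :
    Function.Injective (rosenMetric h p) := by
  refine (injective_iff_map_eq_zero _).2 fun ξ hξ => ?_
  have horth : ∀ η, rosenMetric h p ξ η = 0 := fun η => by rw [hξ]; rfl
  simp only [rosenMetric_apply] at horth
  have hu : ξ.1 = 0 := by simpa using horth (0, 1, 0)
  have hv : ξ.2.1 = 0 := by simpa using horth (1, 0, 0)
  have hx : ξ.2.2 = 0 := by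
    simpa [hi.self_apply_inverse] using horth (0, 0, (h p.1).inverse ξ.2.2)
  exact Prod.ext hu (Prod.ext hv hx)

variable [CompleteSpace X]

theorem surjective_rosenMetric (hi : (h p.1).IsInvertible) :
    Function.Surjective (rosenMetric h p) := by
  intro φ
  let φX : X →L[ℝ] ℝ := φ ∘L .inr ℝ ℝ (ℝ × X) ∘L .inr ℝ ℝ X
  let x : X := -ContinuousLinearMap.adjoint (h p.1).inverse ((InnerProductSpace.toDual ℝ X).symm φX)
  refine ⟨(φ (0, 1, 0), φ (1, 0, 0), x), ContinuousLinearMap.ext fun Z => ?_⟩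
  have hx : ⟪x, h p.1 Z.2.2⟫_ℝ = -φ (0, 0, Z.2.2) := by
    simp [x, φX, ContinuousLinearMap.adjoint_inner_left, hi.inverse_apply_self]
  have hZ : Z = Z.1 • (1, 0, 0) + Z.2.1 • (0, 1, 0) + (0, 0, Z.2.2) := by ext <;> simp
  calc rosenMetric h p (φ (0, 1, 0), φ (1, 0, 0), x) Z
      = Z.1 * φ (1, 0, 0) + Z.2.1 * φ (0, 1, 0) + φ (0, 0, Z.2.2) := by
        rw [rosenMetric_apply, hx]
        ring
    _ = φ Z := by
        conv_rhs => rw [hZ]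
        simp only [map_add, map_smul, smul_eq_mul]

theorem isInvertible_rosenMetric (hi : (h p.1).IsInvertible) : (rosenMetric h p).IsInvertible :=
  isInvertible_of_bijective ⟨injective_rosenMetric hi, surjective_rosenMetric hi⟩

theorem christoffel_rosenMetric (hU : UniqueDiffOn ℝ U) (hp : p ∈ spacetime X U)
    (hd : HasDerivWithinAt h h' U p.1) (hi : (h p.1).IsInvertible) (hsa : IsSelfAdjoint (h p.1))
    (hsa' : IsSelfAdjoint h') (A B : ℝ × ℝ × X) :
    christoffel (rosenMetric h) (spacetime X U) p A B
      = (0, (1 / 2 : ℝ) * ⟪A.2.2, h' B.2.2⟫_ℝ,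
          (1 / 2 : ℝ) • ((h p.1).inverse * h') (A.1 • B.2.2 + B.1 • A.2.2)) := by
  have hraise : ∀ x y : X, ⟪(h p.1).inverse (h' x), h p.1 y⟫_ℝ = ⟪x, h' y⟫_ℝ :=
    inner_inverse_apply_apply hi hsa hsa'
  rw [christoffel, (isInvertible_rosenMetric hi).inverse_apply_eq]
  refine ContinuousLinearMap.ext fun Z => ?_
  simp only [christoffelFirst, smul_apply, sub_apply, add_apply, ContinuousLinearMap.flip_apply,
    fderivWithin_rosenMetric_apply hU hp hd, rosenMetric_apply, mul_apply_eq_comp, map_add,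
    map_smul, real_inner_smul_left, inner_add_left, hraise, smul_eq_mul]
  ring

/-- The data of a Rosen metric on a Hilbert space, of arbitrary signature: `h` is a `C²` field of
invertible self-adjoint operators. -/
structure IsNondegenerateProfile (U : Set ℝ) (h : ℝ → X →L[ℝ] X) : Prop where
  contDiffOn : ContDiffOn ℝ 2 h U
  isSelfAdjoint : ∀ u ∈ U, IsSelfAdjoint (h u)
  isInvertible : ∀ u ∈ U, (h u).IsInvertible

namespace IsNondegenerateProfile

theorem hasDerivWithinAt (hh : IsNondegenerateProfile U h) (hu : u ∈ U) :
    HasDerivWithinAt h (derivWithin h U u) U u :=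
  (hh.contDiffOn.differentiableOn two_ne_zero u hu).hasDerivWithinAt

theorem hasDerivWithinAt_derivWithin (hh : IsNondegenerateProfile U h) (hU : UniqueDiffOn ℝ U)
    (hu : u ∈ U) : HasDerivWithinAt (derivWithin h U) (iteratedDerivWithin 2 h U u) U u := by
  rw [← iteratedDerivWithin_one]
  exact hasDerivWithinAt_iteratedDerivWithin (by norm_num; exact hh.contDiffOn) hU hu

theorem isSelfAdjoint_derivWithin (hh : IsNondegenerateProfile U h) (hU : UniqueDiffOn ℝ U)
    (hu : u ∈ U) : IsSelfAdjoint (derivWithin h U u) :=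
  isSelfAdjoint_of_hasDerivWithinAt (hh.hasDerivWithinAt hu) (hU u hu) hu hh.isSelfAdjoint

theorem isSelfAdjoint_tidalOperator (hh : IsNondegenerateProfile U h) (hU : UniqueDiffOn ℝ U)
    (hu : u ∈ U) : IsSelfAdjoint (tidalOperator U h u) := by
  have hsecond : IsSelfAdjoint (iteratedDerivWithin 2 h U u) :=
    isSelfAdjoint_of_hasDerivWithinAt (hh.hasDerivWithinAt_derivWithin hU hu) (hU u hu) hu
      fun t ht => hh.isSelfAdjoint_derivWithin hU ht
  have hinv : IsSelfAdjoint (h u).inverse := by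
    rw [← ContinuousLinearMap.ringInverse_eq_inverse]
    exact (hh.isSelfAdjoint u hu).ringInverse
  exact hsecond.sub
    (.smul (.all _) (hinv.conjugate_self (hh.isSelfAdjoint_derivWithin hU hu)))

theorem schwarzOperator_eq (hh : IsNondegenerateProfile U h) (hU : UniqueDiffOn ℝ U)
    {H : ℝ → X →L[ℝ] X} (hH : ∀ u ∈ U, HasDerivWithinAt H (h u).inverse U u) (hu : u ∈ U) :
    schwarzOperator U H u = -((h u).inverse * tidalOperator U h u * (h u).inverse) := by
  have hunit : ∀ t ∈ U, IsUnit (h t) := fun t ht =>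
    ContinuousLinearMap.isUnit_iff_bijective.2 (hh.isInvertible t ht).bijective
  have hcancel := Ring.mul_inverse_cancel_left (h u)
    (derivWithin h U u * (h u)⁻¹ʳ) (hunit u hu)
  have hfst : derivWithin H U u = (h u).inverse := (hH u hu).derivWithin (hU u hu)
  rw [schwarzOperator, hfst, (hh.isInvertible u hu).inverse_inverse, tidalOperator]
  simp only [← ContinuousLinearMap.ringInverse_eq_inverse] at hH ⊢
  rw [iteratedDerivWithin_two_of_deriv_eq_ringInverse hU hH hunit
      (fun t => hh.hasDerivWithinAt) hu,
    iteratedDerivWithin_three_of_deriv_eq_ringInverse hU hH hunit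
      (fun t => hh.hasDerivWithinAt) hu (hh.hasDerivWithinAt_derivWithin hU hu)]
  simp only [← ContinuousLinearMap.mul_def, mul_neg, neg_mul, neg_neg, mul_assoc, hcancel,
    mul_sub, sub_mul, mul_smul_comm, smul_mul_assoc, two_mul]
  module

theorem conj_schwarzOperator_apply (hh : IsNondegenerateProfile U h) (hU : UniqueDiffOn ℝ U)
    {H : ℝ → X →L[ℝ] X} (hH : ∀ u ∈ U, HasDerivWithinAt H (h u).inverse U u) (hu : u ∈ U) (x : X) :
    h u (schwarzOperator U H u (h u x)) = -tidalOperator U h u x := by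
  simp [hh.schwarzOperator_eq hU hH hu, (hh.isInvertible u hu).self_apply_inverse,
    (hh.isInvertible u hu).inverse_apply_self]

theorem christoffel_eq (hh : IsNondegenerateProfile U h) (hU : UniqueDiffOn ℝ U)
    (hp : p ∈ spacetime X U) (A B : ℝ × ℝ × X) :
    christoffel (rosenMetric h) (spacetime X U) p A B
      = (0, (1 / 2 : ℝ) * ⟪A.2.2, derivWithin h U p.1 B.2.2⟫_ℝ,
          (1 / 2 : ℝ) • ((h p.1).inverse * derivWithin h U p.1) (A.1 • B.2.2 + B.1 • A.2.2)) :=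
  christoffel_rosenMetric hU hp (hh.hasDerivWithinAt hp) (hh.isInvertible _ hp)
    (hh.isSelfAdjoint _ hp) (hh.isSelfAdjoint_derivWithin hU hp) A B

theorem christoffel_tangent_eq (hh : IsNondegenerateProfile U h) (hU : UniqueDiffOn ℝ U)
    (hp : p ∈ spacetime X U) (ξ : ℝ × ℝ × X) :
    christoffel (rosenMetric h) (spacetime X U) p ξ (1, 0, 0)
      = (0, 0, (1 / 2 : ℝ) • ((h p.1).inverse * derivWithin h U p.1) ξ.2.2) := by
  simp [hh.christoffel_eq hU hp]

theorem christoffel_tangent_tangent_eq_zero (hh : IsNondegenerateProfile U h)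
    (hU : UniqueDiffOn ℝ U) (hp : p ∈ spacetime X U) :
    christoffel (rosenMetric h) (spacetime X U) p (1, 0, 0) (1, 0, 0) = 0 := by
  simp [hh.christoffel_tangent_eq hU hp]

theorem isNullGeodesic_centralCurve (hh : IsNondegenerateProfile U h) (hU : UniqueDiffOn ℝ U) :
    IsNullGeodesic (rosenMetric h) (spacetime X U) U (centralCurve X) := by
  have hT : Set.EqOn (derivWithin (centralCurve X) U) (fun _ => (1, 0, 0)) U := fun u hu =>
    centralTangent_eq (hU u hu)
  refine ⟨fun u hu => hu, ?smooth, fun u hu => ?tangent_ne_zero, fun u hu => ?null,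
    fun u hu => ?geodesic⟩
  case smooth => exact (contDiff_id.prodMk (contDiff_const.prodMk contDiff_const)).contDiffOn
  case tangent_ne_zero => simp [hT hu]
  case null => simp [hT hu, rosenMetric_apply]
  case geodesic =>
    rw [iteratedDerivWithin_succ, iteratedDerivWithin_one, derivWithin_congr hT (hT hu), hT hu,
      hh.christoffel_tangent_tangent_eq_zero (p := centralCurve X u) hU hu]
    simp

theorem hasDerivWithinAt_inverse_mul_derivWithin (hh : IsNondegenerateProfile U h)
    (hU : UniqueDiffOn ℝ U) (hu : u ∈ U) :
    HasDerivWithinAt (fun t => (h t).inverse * derivWithin h U t)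
      ((h u).inverse * (iteratedDerivWithin 2 h U u
        - derivWithin h U u * (h u).inverse * derivWithin h U u)) U u := by
  have hunit := ContinuousLinearMap.isUnit_iff_bijective.2 (hh.isInvertible u hu).bijective
  have hinv := hasDerivWithinAt_ringInverse (hh.hasDerivWithinAt hu) hunit
  rw [ContinuousLinearMap.ringInverse_eq_inverse] at hinv
  exact (hinv.mul (hh.hasDerivWithinAt_derivWithin hU hu)).congr_deriv (by noncomm_ring)

theorem fderivWithin_christoffel_tangent (hh : IsNondegenerateProfile U h) (hU : UniqueDiffOn ℝ U)
    (hp : p ∈ spacetime X U) (ξ : ℝ × ℝ × X) :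
    fderivWithin ℝ (fun q => christoffel (rosenMetric h) (spacetime X U) q ξ (1, 0, 0))
        (spacetime X U) p (1, 0, 0)
      = (0, 0, (1 / 2 : ℝ) • (h p.1).inverse ((iteratedDerivWithin 2 h U p.1
          - derivWithin h U p.1 * (h p.1).inverse * derivWithin h U p.1) ξ.2.2)) := by
  have hcomp := (hasDerivWithinAt_const p.1 U (0 : ℝ)).prodMk
    ((hasDerivWithinAt_const p.1 U (0 : ℝ)).prodMk
      (((hh.hasDerivWithinAt_inverse_mul_derivWithin hU hp).clm_apply
        (hasDerivWithinAt_const p.1 U ξ.2.2)).const_smul (1 / 2 : ℝ)))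
  have hΓ : Set.EqOn (fun q => christoffel (rosenMetric h) (spacetime X U) q ξ (1, 0, 0)) _
    (spacetime X U) := fun q hq => hh.christoffel_tangent_eq hU hq ξ
  rw [fderivWithin_congr hΓ (hΓ hp)]
  refine (congrArg (· (1, 0, 0)) ((hasFDerivWithinAt_comp_fst hcomp).fderivWithin
    (uniqueDiffOn_spacetime hU p hp))).trans ?_
  simp

theorem riemann_eq (hh : IsNondegenerateProfile U h) (hU : UniqueDiffOn ℝ U)
    (hp : p ∈ spacetime X U) (ξ : ℝ × ℝ × X) :
    riemann (rosenMetric h) (spacetime X U) p ξ (1, 0, 0) (1, 0, 0)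
      = (0, 0, -(1 / 2 : ℝ) • (h p.1).inverse (tidalOperator U h p.1 ξ.2.2)) := by
  have hΓ : Set.EqOn (fun q => christoffel (rosenMetric h) (spacetime X U) q (1, 0, 0) (1, 0, 0))
      (fun _ => 0) (spacetime X U) := fun q hq => hh.christoffel_tangent_tangent_eq_zero hU hq
  rw [riemann, fderivWithin_congr hΓ (hΓ hp), hh.fderivWithin_christoffel_tangent hU hp,
    hh.christoffel_tangent_tangent_eq_zero hU hp, hh.christoffel_tangent_eq hU hp]
  simp only [hh.christoffel_eq hU hp, tidalOperator]
  ext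
  · simp
  · simp
  · simp only [fderivWithin_fun_const, Pi.zero_apply, zero_apply, one_div, sub_apply,
      mul_apply_eq_comp, map_sub, zero_sub, Prod.neg_mk, neg_zero, Prod.snd_zero, map_zero,
      inner_zero_right, mul_zero, smul_zero, Prod.fst_zero, zero_smul, add_zero, Prod.mk_add_mk,
      map_smul, inner_zero_left, one_smul, Prod.mk_sub_mk, sub_self, smul_apply, neg_smul]
    module

theorem rosenMetric_riemann (hh : IsNondegenerateProfile U h) (hU : UniqueDiffOn ℝ U)
    (hp : p ∈ spacetime X U) (ξ η : ℝ × ℝ × X) :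
    rosenMetric h p (riemann (rosenMetric h) (spacetime X U) p ξ (1, 0, 0) (1, 0, 0)) η
      = (1 / 2 : ℝ) * ⟪ξ.2.2, tidalOperator U h p.1 η.2.2⟫_ℝ := by
  have hlower := inner_inverse_apply_apply (hh.isInvertible _ hp) (hh.isSelfAdjoint _ hp)
    (hh.isSelfAdjoint_tidalOperator hU hp) ξ.2.2 η.2.2
  rw [hh.riemann_eq hU hp, rosenMetric_apply]
  simp [real_inner_smul_left, hlower]

end IsNondegenerateProfile

theorem IsNondegenerateProfile.isNormalTidalCurvature_rosenTidalForm
    (hh : IsNondegenerateProfile U h) (hU : UniqueDiffOn ℝ U) (hu : u ∈ U) :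
    IsNormalTidalCurvature (rosenMetric h) (spacetime X U) (centralCurve X u)
      (centralTangent X U u) (rosenTidalForm h (hU u hu)) := by
  intro ξ η
  rw [rosenTidalForm_apply]
  simp only [centralTangent_eq (hU u hu)]
  exact (hh.rosenMetric_riemann (p := centralCurve X u) hU hu ξ η).symm

theorem IsRosenProfile.isNondegenerateProfile [FiniteDimensional ℝ X] (hh : IsRosenProfile U h) :
    IsNondegenerateProfile U h where
  contDiffOn := mod_cast contDiffOn_infty.1 hh.smooth 2
  isSelfAdjoint u hu :=
    ContinuousLinearMap.isSelfAdjoint_iff_isSymmetric.2 (hh.symmetric u hu)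
  isInvertible u hu := by
    have hinj : Function.Injective (h u) := (injective_iff_map_eq_zero _).2 fun x hx => by
      by_contra hne
      simpa [hx] using hh.posDef u hu x hne
    exact isInvertible_of_bijective
      ⟨hinj, LinearMap.injective_iff_surjective (f := (h u : X →ₗ[ℝ] X)) |>.1 hinj⟩

end RosenCurvature

theorem mainTheorem12_general {X : Type*} [NormedAddCommGroup X] [InnerProductSpace ℝ X]
    [CompleteSpace X] {U : Set ℝ} (hU : UniqueDiffOn ℝ U) {h : ℝ → X →L[ℝ] X}
    (hh : IsNondegenerateProfile U h) {H : ℝ → X →L[ℝ] X}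
    (hH : ∀ u ∈ U, HasDerivWithinAt H (h u).inverse U u) :
    IsNullGeodesic (rosenMetric h) (spacetime X U) U (centralCurve X) ∧
    ∀ u ∈ U, ∃ P : LinearMap.BilinForm ℝ
        (ScreenSpace (rosenMetric h (centralCurve X u)) (centralTangent X U u)),
      IsNormalTidalCurvature (rosenMetric h) (spacetime X U)
        (centralCurve X u) (centralTangent X U u) P ∧
      (∀ Q, IsNormalTidalCurvature (rosenMetric h) (spacetime X U)
        (centralCurve X u) (centralTangent X U u) Q → Q = P) ∧
      (∀ ξ η : orthVectors (rosenMetric h (centralCurve X u)) (centralTangent X U u),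
        P (screenClass _ _ ξ) (screenClass _ _ η) =
          -(1 / 2) * ⟪formX X ξ, (derivWithin H U u).inverse
            (schwarzOperator U H u ((derivWithin H U u).inverse (formX X η)))⟫_ℝ) ∧
      (∀ L : X →L[ℝ] X, ContinuousLinearMap.adjoint L ∘L L = h u →
        ∀ ξ η : orthVectors (rosenMetric h (centralCurve X u)) (centralTangent X U u),
          P (screenClass _ _ ξ) (screenClass _ _ η) =
            -(1 / 2) * ⟪L (formX X ξ),
              (L ∘L schwarzOperator U H u ∘L ContinuousLinearMap.adjoint L)
                (L (formX X η))⟫_ℝ) := by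
  refine ⟨hh.isNullGeodesic_centralCurve hU, fun u hu => ?_⟩
  have htidal := hh.isNormalTidalCurvature_rosenTidalForm hU hu
  have hform : ∀ ξ η : orthVectors (rosenMetric h (centralCurve X u)) (centralTangent X U u),
      rosenTidalForm h (hU u hu) (screenClass _ _ ξ) (screenClass _ _ η)
        = -(1 / 2) * ⟪formX X ξ, h u (schwarzOperator U H u (h u (formX X η)))⟫_ℝ := fun ξ η => by
    rw [rosenTidalForm_apply, hh.conj_schwarzOperator_apply hU hH hu, inner_neg_right, neg_mul_neg]
  have hinv : (derivWithin H U u).inverse = h u := by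
    rw [(hH u hu).derivWithin (hU u hu), (hh.isInvertible u hu).inverse_inverse]
  refine ⟨rosenTidalForm h (hU u hu), htidal, fun Q hQ => hQ.unique htidal, fun ξ η => ?_,
    fun L hL ξ η => ?_⟩
  · rw [hinv, hform]
  · rw [inner_apply_conj_adjoint_apply, hL, hform]

theorem mainTheorem12 {X : Type*} [NormedAddCommGroup X] [InnerProductSpace ℝ X]
    [FiniteDimensional ℝ X] (U : Set ℝ) (hU : U.OrdConnected) (hU' : U.Nontrivial)
    (h : ℝ → X →L[ℝ] X) (hh : IsRosenProfile U h)
    (H : ℝ → X →L[ℝ] X) (hH : ∀ u ∈ U, HasDerivWithinAt H (h u).inverse U u) :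
    IsNullGeodesic (rosenMetric h) (spacetime X U) U (centralCurve X) ∧
    ∀ u ∈ U, ∃ P : LinearMap.BilinForm ℝ
        (ScreenSpace (rosenMetric h (centralCurve X u)) (centralTangent X U u)),
      IsNormalTidalCurvature (rosenMetric h) (spacetime X U)
        (centralCurve X u) (centralTangent X U u) P ∧
      (∀ Q, IsNormalTidalCurvature (rosenMetric h) (spacetime X U)
        (centralCurve X u) (centralTangent X U u) Q → Q = P) ∧
      (∀ ξ η : orthVectors (rosenMetric h (centralCurve X u)) (centralTangent X U u),
        P (screenClass _ _ ξ) (screenClass _ _ η) =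
          -(1 / 2) * ⟪formX X ξ, (derivWithin H U u).inverse
            (schwarzOperator U H u ((derivWithin H U u).inverse (formX X η)))⟫_ℝ) ∧
      (∀ L : ℝ → X →L[ℝ] X, IsLagrangianMatrix U L →
        (∀ t ∈ U, (euclTranspose (L t)).comp (L t) = h t) →
        ∀ ξ η : orthVectors (rosenMetric h (centralCurve X u)) (centralTangent X U u),
          P (screenClass _ _ ξ) (screenClass _ _ η) =
            -(1 / 2) * ⟪L u (formX X ξ), lagrangeSchwarzian U H L u (L u (formX X η))⟫_ℝ) := by
  have := FiniteDimensional.complete ℝ X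
  have hUdiff : UniqueDiffOn ℝ U :=
    uniqueDiffOn_convex hU.convex (hU.convex.nontrivial_iff_nonempty_interior.1 hU')
  obtain ⟨hgeodesic, htidal⟩ := mainTheorem12_general hUdiff hh.isNondegenerateProfile hH
  refine ⟨hgeodesic, fun u hu => ?_⟩
  obtain ⟨P, hP, hunique, hform, hschwarz⟩ := htidal u hu
  exact ⟨P, hP, hunique, hform, fun L _ hL => hschwarz (L u) (hL u hu)⟩
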